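/- Let $k\ge 1$ be an integer and let $0\le\delta<1/2$. There are constants $c>0$ and $N$, depending only on $k$ and $\delta$, such that the following holds for all integers $m,n\ge 0$, $\varphi\ge 1$ and every real $1\le\alpha<2$ with $\min(m,n^k,(m/\varphi)^k)\ge N$. Consider streams of $m$ transactions, each a $k$-element subset of a set of $n$ items. The support of an itemset is the number of transactions that contain it, and $s_{\max}$ denotes the highest support among the $k$-itemsets all of whose items have support at least $\varphi$. Then there is a probability distribution $D$ on such streams, supported on streams with $s_{\max}\ge 1$, such that every randomized single-pass streaming algorithm which, on each stream with $s_{\max}\ge 1$, outputs with probability at least $1-\delta$ a number $\hat s$ with $s_{\max}/\alpha\le\hat s\le\alpha\, s_{\max}$, uses at least $c\cdot\min(m,n^k,(m/\varphi)^k)$ bits of space in expectation when its input is drawn from $D$ (expectation over the input and over the algorithm's randomness). Here the space used in a run is the largest number of bits held in memory after any number of transactions; the random bits and a counter of the transactions read are free, and the algorithm may depend on $k,m,n,\varphi,\alpha,\delta$. -/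

import Mathlib

open MeasureTheory
open scoped ENNReal

/-- A transaction of size `k` over the `n` items `Fin n`. -/
abbrev Transaction (n k : ℕ) : Type := {T : Finset (Fin n) // T.card = k}

/-- The support of an itemset `S` in the stream `x`: the number of transactions containing `S`. -/
def itemsetSupport {m n k : ℕ} (x : Fin m → Transaction n k) (S : Finset (Fin n)) : ℕ :=
  (Finset.univ.filter fun t : Fin m => S ⊆ (x t).1).card

/-- The highest support among the `k`-itemsets all of whose items have support at least `φ`
(`0` if there is no such itemset). -/
def maxSupport {m n k : ℕ} (φ : ℕ) (x : Fin m → Transaction n k) : ℕ :=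
  ((Finset.univ.powersetCard k).filter
    (fun S : Finset (Fin n) => ∀ i ∈ S, φ ≤ itemsetSupport x {i})).sup (itemsetSupport x)

/-- A randomized single-pass streaming algorithm with input tokens in `T`. The memory content is a
bit string. The random seed `ω : Ω` and the number of tokens read so far are available to the
algorithm at every step and are not charged to its space, and the algorithm may be nonuniform. -/
structure StreamingAlgorithm (Ω : Type*) [MeasurableSpace Ω] (T : Type) where
  /-- initial memory -/
  init : Ω → List Bool
  /-- new memory, from the number of tokens read before, the old memory and the next token -/
  update : Ω → ℕ → List Bool → T → List Bool
  /-- the answer, computed from the final memory -/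
  output : Ω → List Bool → ℝ
  measurable_init : ∀ s, MeasurableSet {ω | init ω = s}
  measurable_update : ∀ t s a s', MeasurableSet {ω | update ω t s a = s'}
  measurable_output : ∀ s, Measurable fun ω => output ω s

namespace StreamingAlgorithm

variable {Ω : Type*} [MeasurableSpace Ω]

/-- The memory content after the first `t` of the `m` tokens of the stream `x`. -/
def memory {T : Type} (A : StreamingAlgorithm Ω T) (ω : Ω) {m : ℕ} (x : Fin m → T) :
    ℕ → List Bool
  | 0 => A.init ω
  | t + 1 => if h : t < m then A.update ω t (memory A ω x t) (x ⟨t, h⟩) else memory A ω x t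

/-- The answer of the algorithm on the stream `x`. -/
def result {T : Type} (A : StreamingAlgorithm Ω T) (ω : Ω) {m : ℕ} (x : Fin m → T) : ℝ :=
  A.output ω (A.memory ω x m)

/-- The space used on the stream `x`: the largest number of bits held in memory at any time. -/
def space {T : Type} (A : StreamingAlgorithm Ω T) (ω : Ω) {m : ℕ} (x : Fin m → T) : ℕ :=
  (Finset.range (m + 1)).sup fun t => (A.memory ω x t).length

/-- On every stream of `m` transactions that contains at least one `k`-itemset of items of support
at least `φ`, the answer is within a factor `α` of `maxSupport φ`, except with probability at
most `δ` over the seed. -/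
def EstimatesMaxSupport {n k : ℕ} (A : StreamingAlgorithm Ω (Transaction n k)) (P : Measure Ω)
    (m φ : ℕ) (α δ : ℝ) : Prop :=
  ∀ x : Fin m → Transaction n k, 0 < maxSupport φ x →
    P {ω | ¬ ((maxSupport φ x : ℝ) / α ≤ A.result ω x ∧
      A.result ω x ≤ α * (maxSupport φ x : ℝ))} ≤ ENNReal.ofReal δ

/-- The expected space, over the input distribution `D` and an independent seed. -/
noncomputable def expectedSpace {n k m : ℕ} (A : StreamingAlgorithm Ω (Transaction n k))
    (P : Measure Ω) (D : PMF (Fin m → Transaction n k)) : ℝ≥0∞ :=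
  ∑ x, D x * ∫⁻ ω, (A.space ω x : ℝ≥0∞) ∂P

end StreamingAlgorithm

/-- The quantity `min (m, n ^ k, (m / φ) ^ k)`. -/
noncomputable def spaceBound (k m n φ : ℕ) : ℝ :=
  min (m : ℝ) (min ((n : ℝ) ^ k) (((m : ℝ) / (φ : ℝ)) ^ k))

/-!
The proof reduces promise disjointness with `24` players to the estimation of `maxSupport`. Every
player holds `u` bits. In the stream, each player in turn writes, for each coordinate, `a` copies of
a `k`-itemset: one shared by all players if the bit is `1`, and one of its own for this player if it is
`0`. A fixed tail makes all items involved frequent and adds at most `5 * a` to the support of any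
`k`-itemset, so the maximal support is at least `24 * a` if some column of bits is all ones, and at
most `6 * a` if no column has two ones. Since the ratio is `4 > α ^ 2`, an approximation of the
maximal support separates the two cases. The itemsets come from a family (`digitItemset`) of
`q ^ k` itemsets on `k * q` items in which every `q` consecutive members cover all items once; thus
the tail reaches the frequency threshold `φ` with only `φ * q` transactions. With `q` about
`min (n, m / φ) / k` and `a` about `m / u`, the number `u` of coordinates is of the order of
`min (m, q ^ k)`.

The hard distribution gives each coordinate a uniformly random owner; the owner's bit is uniform and
all other bits of the column are `0` (`ownedBits`). Replacing one column by all ones must change the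
answer with probability at least `1 - 2 * δ`. This change is split into hybrids
`0, …, 0, 1, …, 1`. Two neighbouring hybrids differ in the bit of one player `p`, and conditioned on
`p` owning the coordinate, the players before `p` see exactly the hard distribution; since
communication is one-way, the difference is the correlation of a uniform bit of `p` with a function
of the memory after the segment of `p` (`sum_step_sub_sum_step`). For all `u` coordinates together,
such correlations are bounded by the length of the memory (`sum_bitSign_mul_le`): a message of
length `s` has weight `4 ^ (-s)`, these weights have bounded sum, and for each fixed message the
exponential moment of the signed sum of the bits is subgaussian. Summing over players
(`sum_column_sub_le`) and averaging over the seed (`le_sum_lintegral_space`) bounds the expected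
space below by a constant times `u`.
-/

/-! ### Correlation of uniform bits with a short message -/

lemma sum_sum_update {ι α : Type*} [Fintype ι] [DecidableEq ι] [Fintype α] (i : ι)
    (g : (ι → α) → ℝ) :
    ∑ P, ∑ a, g (Function.update P i a) = Fintype.card α * ∑ P, g P := by
  let σ : (ι → α) × α → (ι → α) × α := fun x => (Function.update x.1 i x.2, x.1 i)
  have hσ : Function.Involutive σ := fun x => by simp [σ]
  calc ∑ P, ∑ a, g (Function.update P i a) = ∑ x : (ι → α) × α, g (σ x).1 := by
        rw [Fintype.sum_prod_type]
    _ = ∑ x : (ι → α) × α, g x.1 := Equiv.sum_comp hσ.toPerm (fun x => g x.1)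
    _ = Fintype.card α * ∑ P, g P := by
        rw [Fintype.sum_prod_type]
        simp [Finset.mul_sum]

lemma sum_sum_update_update {ι κ α : Type*} [Fintype ι] [DecidableEq ι] [Fintype κ]
    [DecidableEq κ] [Fintype α] (i : ι) (j : κ) (f : (ι → κ → α) → ℝ) :
    ∑ Y, ∑ b, f (Function.update Y i (Function.update (Y i) j b)) =
      Fintype.card α * ∑ Y, f Y := by
  rcases isEmpty_or_nonempty α with h | h
  · have : IsEmpty (ι → κ → α) := ⟨fun Y => h.elim (Y i j)⟩
    simp
  have h1 := sum_sum_update i (fun Y : ι → κ → α =>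
    ∑ b, f (Function.update Y i (Function.update (Y i) j b)))
  have h2 := sum_sum_update i f
  simp only [Function.update_idem, Function.update_self] at h1
  have h3 : ∀ Y : ι → κ → α, ∑ Z : κ → α, ∑ b, f (Function.update Y i (Function.update Z j b)) =
      Fintype.card α * ∑ Z, f (Function.update Y i Z) := fun Y =>
    sum_sum_update j (fun Z => f (Function.update Y i Z))
  simp only [h3, ← Finset.mul_sum, h2] at h1
  have hc : (Fintype.card (κ → α) : ℝ) ≠ 0 := by
    exact_mod_cast Fintype.card_ne_zero
  apply mul_left_cancel₀ hc
  rw [← h1]; ring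

lemma sum_four_pow_length_le (F : Finset (List Bool)) :
    ∑ s ∈ F, ((1 / 4 : ℝ)) ^ s.length ≤ 2 := by
  have hcard : ∀ l, (F.filter fun s => s.length = l).card ≤ 2 ^ l := by
    intro l
    have : (F.filter fun s => s.length = l).card ≤
        (Finset.univ : Finset (List.Vector Bool l)).card := by
      apply Finset.card_le_card_of_surjOn (fun v => v.1)
      intro s hs
      have hs' := (Finset.mem_filter.1 (Finset.mem_coe.1 hs)).2
      exact ⟨⟨s, hs'⟩, Finset.mem_coe.2 (Finset.mem_univ _), rfl⟩
    simpa using this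
  rw [← Finset.sum_fiberwise_of_maps_to (t := Finset.range (F.sup List.length + 1))
    (g := List.length) (fun s hs => by
      simpa [Nat.lt_succ_iff] using Finset.le_sup (f := List.length) hs)]
  calc _ ≤ ∑ l ∈ Finset.range (F.sup List.length + 1), (1 / 2 : ℝ) ^ l := by
        refine Finset.sum_le_sum fun l _ => ?_
        rw [Finset.sum_congr rfl (g := fun _ => (1 / 4 : ℝ) ^ l)
          (fun s hs => by rw [(Finset.mem_filter.1 hs).2])]
        rw [Finset.sum_const, nsmul_eq_mul]
        calc _ ≤ ((2 : ℝ) ^ l) * (1 / 4) ^ l := by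
              gcongr; exact_mod_cast hcard l
          _ = _ := by rw [← mul_pow]; norm_num
    _ ≤ 2 := sum_geometric_two_le _

/-- The sign attached to a bit: `1` for `true`, `-1` for `false`. -/
def bitSign (b : Bool) : ℝ := if b then 1 else -1

lemma sum_exp_bitSign_le {u : ℕ} (lam : ℝ) (w : Fin u → ℝ) (hw : ∀ e, |w e| ≤ 1) :
    ∑ Z : Fin u → Bool, Real.exp (lam * ∑ e, bitSign (Z e) * w e) ≤
      2 ^ u * Real.exp (lam ^ 2 * u / 2) := by
  have h : ∀ Z : Fin u → Bool, Real.exp (lam * ∑ e, bitSign (Z e) * w e) =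
      ∏ e, Real.exp (lam * (bitSign (Z e) * w e)) := fun Z => by
    rw [← Real.exp_sum, Finset.mul_sum]
  simp only [h]
  rw [← Fintype.prod_sum (fun e (b : Bool) => Real.exp (lam * (bitSign b * w e)))]
  calc _ ≤ ∏ _e : Fin u, (2 * Real.exp (lam ^ 2 / 2)) := by
        refine Finset.prod_le_prod (fun e _ => by positivity) fun e _ => ?_
        have h1 := Real.cosh_le_exp_half_sq (lam * w e)
        have h2 : Real.exp ((lam * w e) ^ 2 / 2) ≤ Real.exp (lam ^ 2 / 2) := by
          have : (w e) ^ 2 ≤ 1 := (sq_le_one_iff_abs_le_one _).2 (hw e)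
          apply Real.exp_le_exp.2
          rw [mul_pow]
          nlinarith [sq_nonneg lam]
        rw [Real.cosh_eq] at h1
        simp only [Fintype.sum_bool, bitSign, if_true, one_mul, Bool.false_eq_true, if_false,
          neg_mul, mul_neg]
        linarith
    _ = _ := by
        rw [Finset.prod_const, mul_pow, ← Real.exp_nat_mul]
        simp only [Finset.card_univ, Fintype.card_fin]
        congr 2; ring

/-- A message `g Z` about uniform bits `Z` correlates little with these bits: if every weight
`w e` is a function of the message, the total correlation of the `w e` with the bits `Z e` is
controlled by the average length of the message. The exponential moment of
`lam * ∑ e, bitSign (Z e) * w e` is bounded for each fixed message, and a union over the messages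
costs the factor `4 ^ length`. -/
lemma sum_bitSign_mul_le {u : ℕ} (lam : ℝ) (hlam : 0 < lam) (g : (Fin u → Bool) → List Bool)
    (w : Fin u → (Fin u → Bool) → ℝ) (hw : ∀ e Z, |w e Z| ≤ 1)
    (hg : ∀ e Z Z', g Z = g Z' → w e Z = w e Z') :
    ∑ Z : Fin u → Bool, ∑ e, bitSign (Z e) * w e Z ≤
      ∑ Z : Fin u → Bool, (lam * u / 2 + (2 * (g Z).length + 1) / lam) := by
  classical
  set W : List Bool → Fin u → ℝ := fun s e => w e (Function.invFun g s) with hW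
  have hWg : ∀ Z e, W (g Z) e = w e Z := fun Z e => hg _ _ _ (Function.invFun_eq ⟨Z, rfl⟩)
  set F := Finset.univ.image g
  set C := Real.exp (lam ^ 2 * u / 2) with hC
  have hmain : ∑ Z : Fin u → Bool, (1 / 4 : ℝ) ^ (g Z).length *
      Real.exp (lam * ∑ e, bitSign (Z e) * w e Z) ≤ 2 * (2 ^ u * C) := by
    calc _ ≤ ∑ Z : Fin u → Bool, ∑ s ∈ F, (1 / 4 : ℝ) ^ s.length *
          Real.exp (lam * ∑ e, bitSign (Z e) * W s e) := by
          refine Finset.sum_le_sum fun Z _ => ?_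
          have := Finset.single_le_sum (s := F) (f := fun s => (1 / 4 : ℝ) ^ s.length *
            Real.exp (lam * ∑ e, bitSign (Z e) * W s e)) (fun s _ => by positivity)
            (Finset.mem_image_of_mem g (Finset.mem_univ Z))
          simpa only [hWg] using this
      _ = ∑ s ∈ F, (1 / 4 : ℝ) ^ s.length *
          ∑ Z : Fin u → Bool, Real.exp (lam * ∑ e, bitSign (Z e) * W s e) := by
          rw [Finset.sum_comm]; simp only [Finset.mul_sum]
      _ ≤ ∑ s ∈ F, (1 / 4 : ℝ) ^ s.length * (2 ^ u * C) := by
          refine Finset.sum_le_sum fun s _ => ?_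
          gcongr
          exact sum_exp_bitSign_le lam _ fun e => hw _ _
      _ ≤ _ := by
          rw [← Finset.sum_mul]
          gcongr
          exact sum_four_pow_length_le F
  have hlog4 : Real.log 4 ≤ 2 := by
    rw [show (4 : ℝ) = 2 ^ 2 by norm_num, Real.log_pow]
    have := Real.log_two_lt_d9
    push_cast; linarith
  have hlog2 : Real.log 2 ≤ 1 := by have := Real.log_two_lt_d9; linarith
  -- `1 + z ≤ exp z` takes the place of Jensen's inequality.
  have hpt : ∀ Z : Fin u → Bool,
      1 + (lam * ∑ e, bitSign (Z e) * w e Z - lam ^ 2 * u / 2 - 2 * (g Z).length - 1) ≤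
      (1 / 4 : ℝ) ^ (g Z).length * Real.exp (lam * ∑ e, bitSign (Z e) * w e Z) / (2 * C) := by
    intro Z
    have h4 : (1 / 4 : ℝ) ^ (g Z).length = Real.exp (-((g Z).length * Real.log 4)) := by
      rw [Real.exp_neg, Real.exp_nat_mul, Real.exp_log (by norm_num), one_div, inv_pow]
    have h2 : (2 : ℝ) = Real.exp (Real.log 2) := (Real.exp_log (by norm_num)).symm
    have : (1 / 4 : ℝ) ^ (g Z).length * Real.exp (lam * ∑ e, bitSign (Z e) * w e Z) / (2 * C) =
        Real.exp (lam * ∑ e, bitSign (Z e) * w e Z - lam ^ 2 * u / 2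
          - (g Z).length * Real.log 4 - Real.log 2) := by
      rw [h4, hC]
      nth_rewrite 1 [h2]
      rw [← Real.exp_add, ← Real.exp_add, ← Real.exp_sub]
      congr 1; ring
    rw [this]
    refine le_trans ?_ (Real.add_one_le_exp _)
    have : ((g Z).length : ℝ) * Real.log 4 ≤ (g Z).length * 2 := by gcongr
    linarith
  have hsum := Finset.sum_le_sum fun Z (_ : Z ∈ (Finset.univ : Finset (Fin u → Bool))) => hpt Z
  rw [← Finset.sum_div] at hsum
  have hle : (∑ Z : Fin u → Bool, (1 / 4 : ℝ) ^ (g Z).length *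
      Real.exp (lam * ∑ e, bitSign (Z e) * w e Z)) / (2 * C) ≤ 2 ^ u := by
    rw [div_le_iff₀ (by positivity)]; linarith
  have hsum' := hsum.trans hle
  simp only [Finset.sum_add_distrib, Finset.sum_sub_distrib, Finset.sum_const, Finset.card_univ,
    Fintype.card_fun, Fintype.card_bool, Fintype.card_fin, nsmul_eq_mul, mul_one, Nat.cast_pow,
    Nat.cast_ofNat, ← Finset.mul_sum, ← Finset.sum_div] at hsum' ⊢
  rw [← mul_le_mul_iff_right₀ hlam]
  have : lam * (2 ^ u * (lam * u / 2) +
      (2 * ∑ Z : Fin u → Bool, ((g Z).length : ℝ) + 2 ^ u) / lam) =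
      2 ^ u * (lam ^ 2 * u / 2) + 2 * ∑ Z : Fin u → Bool, ((g Z).length : ℝ) + 2 ^ u := by
    field_simp
    ring
  rw [this]
  linarith

/-! ### One-way promise disjointness -/

/-- The bits of `t` players over `u` coordinates when coordinate `e` belongs to player `P e`: only
the owner of a coordinate can hold a `1` there, and does so according to `Y`. -/
def ownedBits {t u : ℕ} (P : Fin u → Fin t) (Y : Fin t → Fin u → Bool) : Fin t → Fin u → Bool :=
  fun p e => decide (P e = p) && Y p e

/-- The bit array `β` with column `e` replaced by `v`. -/
def setColumn {t u : ℕ} (e : Fin u) (v : Fin t → Bool) (β : Fin t → Fin u → Bool) :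
    Fin t → Fin u → Bool :=
  fun p => Function.update (β p) e (v p)

/-- The column of a hybrid: the players before `j` hold `0`, the others `1`. -/
def stepColumn {t : ℕ} (j : ℕ) : Fin t → Bool := fun q => decide (j ≤ q)

/-- The column `0, …, 0, b, 1, …, 1` with the bit `b` at player `p`. -/
def pivotColumn {t : ℕ} (p : Fin t) (b : Bool) : Fin t → Bool :=
  fun q => if q < p then false else if q = p then b else true

lemma pivotColumn_true {t : ℕ} (p : Fin t) : pivotColumn p true = stepColumn (p : ℕ) := by
  funext q
  simp only [pivotColumn, stepColumn, Fin.lt_def, Fin.ext_iff]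
  grind

lemma pivotColumn_false {t : ℕ} (p : Fin t) :
    pivotColumn p false = stepColumn ((p : ℕ) + 1) := by
  funext q
  simp only [pivotColumn, stepColumn, Fin.lt_def, Fin.ext_iff]
  grind

lemma setColumn_congr {t u : ℕ} (e : Fin u) (v : Fin t → Bool) {β β' : Fin t → Fin u → Bool}
    (h : ∀ p e', e' ≠ e → β p e' = β' p e') : setColumn e v β = setColumn e v β' := by
  funext p e'
  by_cases he : e' = e
  · subst he; simp [setColumn]
  · simp [setColumn, Function.update_of_ne he, h p e' he]

/-- The difference of two neighbouring hybrids at player `p` is the correlation of the pivot bit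
with the outcome, restricted to the event that `p` owns the coordinate `e`; that event has
probability `1 / t`, and the pivot bit takes each value with probability `1 / 2`. -/
lemma sum_step_sub_sum_step {t u : ℕ} (out : (Fin t → Fin u → Bool) → ℝ) (p : Fin t)
    (e : Fin u) :
    ∑ P : Fin u → Fin t, ∑ Y : Fin t → Fin u → Bool,
        (out (setColumn e (stepColumn (p : ℕ)) (ownedBits P Y)) -
          out (setColumn e (stepColumn ((p : ℕ) + 1)) (ownedBits P Y))) =
      2 * t * ∑ P : Fin u → Fin t, ∑ Y : Fin t → Fin u → Bool, bitSign (Y p e) *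
        (if P e = p then out (setColumn e (pivotColumn p (Y p e)) (ownedBits P Y)) else 0) := by
  have hP := sum_sum_update e (fun P : Fin u → Fin t => ∑ Y : Fin t → Fin u → Bool,
    bitSign (Y p e) *
      (if P e = p then out (setColumn e (pivotColumn p (Y p e)) (ownedBits P Y)) else 0))
  have hcolP : ∀ (P : Fin u → Fin t) a Y v,
      setColumn e v (ownedBits (Function.update P e a) Y) = setColumn e v (ownedBits P Y) := by
    intro P a Y v
    apply setColumn_congr
    intro q e' he
    simp [ownedBits, Function.update_of_ne he]
  have hcolY : ∀ (P : Fin u → Fin t) (Y : Fin t → Fin u → Bool) b v,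
      setColumn e v (ownedBits P (Function.update Y p (Function.update (Y p) e b))) =
        setColumn e v (ownedBits P Y) := by
    intro P Y b v
    apply setColumn_congr
    intro q e' he
    by_cases hq : q = p
    · subst hq; simp [ownedBits, Function.update_of_ne he]
    · simp [ownedBits, Function.update_of_ne hq]
  have hY : ∀ P : Fin u → Fin t, _ := fun P => sum_sum_update_update p e
    (fun Y : Fin t → Fin u → Bool =>
      bitSign (Y p e) * out (setColumn e (pivotColumn p (Y p e)) (ownedBits P Y)))
  simp only [Function.update_self, hcolY, Fintype.sum_bool, bitSign, pivotColumn_true,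
    pivotColumn_false, if_true, Bool.false_eq_true, if_false, one_mul, neg_mul,
    Fintype.card_bool, ← sub_eq_add_neg, Nat.cast_ofNat] at hY
  simp only [hY, ← Finset.mul_sum]
  rw [mul_assoc]
  congr 1
  rw [Fintype.card_fin] at hP
  rw [← hP]
  refine Finset.sum_congr rfl fun P _ => ?_
  rw [Finset.sum_comm]
  refine Finset.sum_congr rfl fun Y _ => ?_
  simp only [hcolP, Function.update_self]
  rw [Finset.sum_eq_single p (fun b _ hb => by simp [hb]) (by simp)]
  simp [bitSign]

/-- One-way communication bound for promise disjointness. `mem p β` is the message after player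
`p`; it depends on the bits of the players up to `p`, and together with the bits of the later
players it determines the outcome. Distinguishing an all-`1` from an all-`0` column in every
coordinate forces long messages on the inputs `ownedBits P Y`, in none of which a column has two
ones. -/
lemma sum_column_sub_le {t u : ℕ} (lam : ℝ) (hlam : 0 < lam)
    (mem : Fin t → (Fin t → Fin u → Bool) → List Bool) (out : (Fin t → Fin u → Bool) → ℝ)
    (hout : ∀ β, |out β| ≤ 1)
    (hmem : ∀ p β β', (∀ q ≤ p, β q = β' q) → mem p β = mem p β')
    (hfac : ∀ p β β', mem p β = mem p β' → (∀ q > p, β q = β' q) → out β = out β') :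
    ∑ P : Fin u → Fin t, ∑ Y : Fin t → Fin u → Bool, ∑ e : Fin u,
        (out (setColumn e (fun _ => true) (ownedBits P Y)) -
          out (setColumn e (fun _ => false) (ownedBits P Y))) ≤
      2 * t * ∑ P : Fin u → Fin t, ∑ Y : Fin t → Fin u → Bool, ∑ p : Fin t,
        (lam * u / 2 + (2 * (mem p (ownedBits P Y)).length + 1) / lam) := by
  have htel : ∀ (e : Fin u) (β : Fin t → Fin u → Bool),
      out (setColumn e (fun _ => true) β) - out (setColumn e (fun _ => false) β) =
      ∑ p : Fin t, (out (setColumn e (stepColumn (p : ℕ)) β) -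
        out (setColumn e (stepColumn ((p : ℕ) + 1)) β)) := by
    intro e β
    rw [Fin.sum_univ_eq_sum_range (fun p => out (setColumn e (stepColumn p) β) -
      out (setColumn e (stepColumn (p + 1)) β)) t, Finset.sum_range_sub']
    congr 3
    funext q; simp [stepColumn]
  have hstep : ∀ (p : Fin t) (P : Fin u → Fin t),
      ∑ Y : Fin t → Fin u → Bool, ∑ e : Fin u, bitSign (Y p e) *
        (if P e = p then out (setColumn e (pivotColumn p (Y p e)) (ownedBits P Y)) else 0) ≤
      ∑ Y : Fin t → Fin u → Bool,
        (lam * u / 2 + (2 * (mem p (ownedBits P Y)).length + 1) / lam) := by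
    intro p P
    have hc : (0 : ℝ) < Fintype.card (Fin u → Bool) := by exact_mod_cast Fintype.card_pos
    rw [← mul_le_mul_iff_right₀ hc, ← sum_sum_update p, ← sum_sum_update p]
    refine Finset.sum_le_sum fun Y _ => ?_
    simp only [Function.update_self]
    refine sum_bitSign_mul_le lam hlam
      (fun Z => mem p (ownedBits P (Function.update Y p Z)))
      (fun e Z => if P e = p then out (setColumn e (pivotColumn p (Z e))
        (ownedBits P (Function.update Y p Z))) else 0) ?_ ?_
    · intro e Z
      split_ifs
      · exact hout _
      · simp
    · intro e Z Z' hZ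
      split_ifs with hP
      · -- If `p` owns `e`, the hybrid agrees with the original array up to player `p`.
        have hpre : ∀ Z, mem p (setColumn e (pivotColumn p (Z e))
            (ownedBits P (Function.update Y p Z))) =
              mem p (ownedBits P (Function.update Y p Z)) := by
          intro Z
          apply hmem
          intro q hq
          rw [setColumn, Function.update_eq_self_iff]
          rcases hq.lt_or_eq with h | h
          · simp [pivotColumn, ownedBits, h, hP, h.ne']
          · subst h; simp [pivotColumn, ownedBits, hP]
        apply hfac p
        · rw [hpre, hpre, hZ]
        · intro q hq
          have h1 : ownedBits P (Function.update Y p Z) q =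
              ownedBits P (Function.update Y p Z') q := by
            funext e'; simp [ownedBits, Function.update_of_ne hq.ne']
          rw [setColumn, setColumn, h1]
          simp [pivotColumn, hq.not_gt, hq.ne']
      · rfl
  calc _ = ∑ e : Fin u, ∑ p : Fin t, ∑ P : Fin u → Fin t, ∑ Y : Fin t → Fin u → Bool,
        (out (setColumn e (stepColumn (p : ℕ)) (ownedBits P Y)) -
          out (setColumn e (stepColumn ((p : ℕ) + 1)) (ownedBits P Y))) := by
        simp only [htel]
        simp_rw [Finset.sum_comm (s := (Finset.univ : Finset (Fin t → Fin u → Bool)))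
          (t := (Finset.univ : Finset (Fin u)))]
        rw [Finset.sum_comm]
        refine Finset.sum_congr rfl fun e _ => ?_
        simp_rw [Finset.sum_comm (s := (Finset.univ : Finset (Fin t → Fin u → Bool)))
          (t := (Finset.univ : Finset (Fin t)))]
        rw [Finset.sum_comm]
    _ = 2 * t * ∑ p : Fin t, ∑ P : Fin u → Fin t, ∑ Y : Fin t → Fin u → Bool, ∑ e : Fin u,
        bitSign (Y p e) * (if P e = p then
          out (setColumn e (pivotColumn p (Y p e)) (ownedBits P Y)) else 0) := by
        simp only [sum_step_sub_sum_step, ← Finset.mul_sum]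
        congr 1
        rw [Finset.sum_comm]
        refine Finset.sum_congr rfl fun p _ => ?_
        rw [Finset.sum_comm]
        refine Finset.sum_congr rfl fun P _ => ?_
        rw [Finset.sum_comm]
    _ ≤ 2 * t * ∑ p : Fin t, ∑ P : Fin u → Fin t, ∑ Y : Fin t → Fin u → Bool,
        (lam * u / 2 + (2 * (mem p (ownedBits P Y)).length + 1) / lam) := by
        refine mul_le_mul_of_nonneg_left (Finset.sum_le_sum fun p _ =>
          Finset.sum_le_sum fun P _ => hstep p P) (by positivity)
    _ = _ := by
        congr 1
        rw [Finset.sum_comm]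
        refine Finset.sum_congr rfl fun P _ => ?_
        rw [Finset.sum_comm]

/-! ### Streaming algorithms on encoded bit arrays -/

namespace StreamingAlgorithm

variable {Ω : Type*} [MeasurableSpace Ω] {T : Type} (A : StreamingAlgorithm Ω T) (ω : Ω)

lemma memory_congr {m : ℕ} {x y : Fin m → T} (s : ℕ) (h : ∀ i : Fin m, (i : ℕ) < s → x i = y i) :
    A.memory ω x s = A.memory ω y s := by
  induction s with
  | zero => rfl
  | succ s ih =>
    have ih' := ih fun i hi => h i (by omega)
    simp only [memory, ih']
    split_ifs with hs
    · rw [h ⟨s, hs⟩ (by simp)]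
    · rfl

lemma memory_congr_of_memory_eq {m : ℕ} {x y : Fin m → T} {s : ℕ}
    (hxy : A.memory ω x s = A.memory ω y s) (h : ∀ i : Fin m, s ≤ (i : ℕ) → x i = y i)
    {s' : ℕ} (hs : s ≤ s') : A.memory ω x s' = A.memory ω y s' := by
  induction s', hs using Nat.le_induction with
  | base => exact hxy
  | succ r hr ih =>
    simp only [memory, ih]
    split_ifs with hs
    · rw [h ⟨r, hs⟩ hr]
    · rfl

lemma length_memory_le_space {m : ℕ} (x : Fin m → T) {s : ℕ} (hs : s ≤ m) :
    (A.memory ω x s).length ≤ A.space ω x :=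
  Finset.le_sup (f := fun t => (A.memory ω x t).length) (by simpa [Nat.lt_succ_iff] using hs)

lemma measurableSet_memory_eq {m : ℕ} (x : Fin m → T) (s : ℕ) (l : List Bool) :
    MeasurableSet {ω | A.memory ω x s = l} := by
  induction s generalizing l with
  | zero => exact A.measurable_init l
  | succ s ih =>
    by_cases hs : s < m
    · have : {ω | A.memory ω x (s + 1) = l} =
          ⋃ l', {ω | A.memory ω x s = l'} ∩ {ω | A.update ω s l' (x ⟨s, hs⟩) = l} := by
        ext ω
        simp [memory, hs]
      rw [this]
      exact MeasurableSet.iUnion fun l' => (ih l').inter (A.measurable_update _ _ _ _)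
    · simpa [memory, hs] using ih l

lemma measurable_space {m : ℕ} (x : Fin m → T) : Measurable fun ω => A.space ω x := by
  unfold space
  simp only [← Finset.sup'_eq_sup Finset.nonempty_range_add_one]
  refine Finset.measurable_range_sup'' fun s _ => ?_
  refine measurable_to_countable' fun k => ?_
  have : (fun ω => (A.memory ω x s).length) ⁻¹' {k} =
      ⋃ l : List Bool, ⋃ _ : l.length = k, {ω | A.memory ω x s = l} := by
    ext ω; simp
  rw [this]
  exact MeasurableSet.iUnion fun l => MeasurableSet.iUnion fun _ =>
    A.measurableSet_memory_eq x s l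

lemma measurable_result {m : ℕ} (x : Fin m → T) : Measurable fun ω => A.result ω x := by
  intro B hB
  have : (fun ω => A.result ω x) ⁻¹' B =
      ⋃ l : List Bool, {ω | A.memory ω x m = l} ∩ {ω | A.output ω l ∈ B} := by
    ext ω; simp [result]
  rw [this]
  exact MeasurableSet.iUnion fun l => (A.measurableSet_memory_eq x m l).inter
    (A.measurable_output l hB)

end StreamingAlgorithm

/-- Space bound for streams that encode promise disjointness. The stream `enc β` consists of
consecutive segments, the one of player `p` ending at time `τ p` and depending on the bits of
player `p` only, and the algorithm separates streams with an all-`1` column from streams with an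
all-`0` column by means of the threshold `θ`. -/
lemma le_sum_lintegral_space {Ω : Type*} [MeasurableSpace Ω] (μ : Measure Ω)
    [IsProbabilityMeasure μ] {T : Type} (A : StreamingAlgorithm Ω T) {m t u : ℕ} (ht : 0 < t)
    (enc : (Fin t → Fin u → Bool) → Fin m → T) (τ : Fin t → ℕ) (hτ : ∀ p, τ p ≤ m)
    (hpre : ∀ p β β', (∀ q ≤ p, β q = β' q) → ∀ i : Fin m, (i : ℕ) < τ p → enc β i = enc β' i)
    (hsuf : ∀ p β β', (∀ q > p, β q = β' q) → ∀ i : Fin m, τ p ≤ (i : ℕ) → enc β i = enc β' i)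
    {θ δ : ℝ} (hδ0 : 0 ≤ δ) (hδ : δ < 1 / 2)
    (hone : ∀ P Y e, μ {ω | ¬ θ ≤ A.result ω (enc (setColumn e (fun _ => true)
      (ownedBits P Y)))} ≤ ENNReal.ofReal δ)
    (hzero : ∀ P Y e, μ {ω | θ ≤ A.result ω (enc (setColumn e (fun _ => false)
      (ownedBits P Y)))} ≤ ENNReal.ofReal δ) :
    ENNReal.ofReal ((Fintype.card ((Fin u → Fin t) × (Fin t → Fin u → Bool)) : ℝ) *
      ((1 - 2 * δ) ^ 2 * u / (16 * t ^ 4) - 1 / 2)) ≤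
    ∑ z : (Fin u → Fin t) × (Fin t → Fin u → Bool),
      ∫⁻ ω, (A.space ω (enc (ownedBits z.1 z.2)) : ℝ≥0∞) ∂μ := by
  classical
  set κ := Fintype.card ((Fin u → Fin t) × (Fin t → Fin u → Bool)) with hκ
  have hms : ∀ x : Fin m → T, Measurable fun ω => (A.space ω x : ℝ≥0∞) := fun x =>
    (measurable_from_top (f := fun n : ℕ => (n : ℝ≥0∞))).comp (A.measurable_space x)
  rw [← lintegral_finsetSum _ fun z _ => hms _]
  by_cases htop : ∫⁻ ω, ∑ z : (Fin u → Fin t) × (Fin t → Fin u → Bool),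
      (A.space ω (enc (ownedBits z.1 z.2)) : ℝ≥0∞) ∂μ = ⊤
  · rw [htop]; exact le_top
  set S : Ω → ℝ := fun ω => ∑ z : (Fin u → Fin t) × (Fin t → Fin u → Bool),
      (A.space ω (enc (ownedBits z.1 z.2)) : ℝ) with hS
  have hSof : ∀ ω, ∑ z : (Fin u → Fin t) × (Fin t → Fin u → Bool),
      (A.space ω (enc (ownedBits z.1 z.2)) : ℝ≥0∞) = ENNReal.ofReal (S ω) := by
    intro ω
    rw [hS, ENNReal.ofReal_sum_of_nonneg fun _ _ => by positivity]
    simp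
  have hS0 : ∀ ω, 0 ≤ S ω := fun ω => Finset.sum_nonneg fun _ _ => by positivity
  have hSm : Measurable S := Finset.measurable_sum _ fun z _ =>
    (measurable_from_top (f := fun n : ℕ => (n : ℝ))).comp (A.measurable_space _)
  simp only [hSof] at htop ⊢
  have hSi : Integrable S μ := by
    refine ⟨hSm.aestronglyMeasurable, ?_⟩
    rw [hasFiniteIntegral_iff_ofReal (Filter.Eventually.of_forall hS0)]
    exact lt_top_iff_ne_top.2 htop
  rw [← ofReal_integral_eq_lintegral_ofReal hSi (Filter.Eventually.of_forall hS0)]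
  apply ENNReal.ofReal_le_ofReal
  -- the event that the answer on the stream `x` is high
  set hi : (Fin m → T) → Set Ω := fun x => {ω | θ ≤ A.result ω x} with hhi
  have hhim : ∀ x, MeasurableSet (hi x) := fun x =>
    measurableSet_le measurable_const (A.measurable_result x)
  set out : Ω → (Fin t → Fin u → Bool) → ℝ := fun ω β => (hi (enc β)).indicator 1 ω with hout
  have houti : ∀ β, Integrable (fun ω => out ω β) μ := fun β =>
    (integrable_const (1 : ℝ)).indicator (hhim _)
  have houtint : ∀ β, ∫ ω, out ω β ∂μ = μ.real (hi (enc β)) := fun β =>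
    integral_indicator_one (hhim _)
  set lam : ℝ := (1 - 2 * δ) / (2 * t ^ 2) with hlam
  have ht' : (0 : ℝ) < t := by exact_mod_cast ht
  have hlam0 : 0 < lam := by
    have : 0 < 1 - 2 * δ := by linarith
    positivity
  have key : ∀ ω, ∑ z : (Fin u → Fin t) × (Fin t → Fin u → Bool), ∑ e : Fin u,
        (out ω (setColumn e (fun _ => true) (ownedBits z.1 z.2)) -
          out ω (setColumn e (fun _ => false) (ownedBits z.1 z.2))) ≤
      2 * t * (κ * (t * (lam * u / 2 + 1 / lam)) + t * (2 / lam) * S ω) := by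
    intro ω
    have := sum_column_sub_le lam hlam0 (fun p β => A.memory ω (enc β) (τ p)) (out ω)
      (fun β => by
        simp only [hout, Set.indicator_apply]; split_ifs <;> simp)
      (fun p β β' h => A.memory_congr ω _ (hpre p β β' h))
      (fun p β β' h h' => by
        have hr : A.result ω (enc β) = A.result ω (enc β') := by
          unfold StreamingAlgorithm.result
          rw [A.memory_congr_of_memory_eq ω h (hsuf p β β' h') (hτ p)]
        simp only [hout, hhi, Set.indicator_apply, Set.mem_ofPred_eq, hr])
    rw [Fintype.sum_prod_type]
    refine this.trans ?_
    rw [← Fintype.sum_prod_type' (f := fun P Y => ∑ p : Fin t,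
        (lam * u / 2 + (2 * ((A.memory ω (enc (ownedBits P Y)) (τ p)).length : ℝ) + 1) / lam))]
    gcongr
    calc _ ≤ ∑ z : (Fin u → Fin t) × (Fin t → Fin u → Bool), ∑ p : Fin t,
          (lam * u / 2 + (2 * (A.space ω (enc (ownedBits z.1 z.2)) : ℝ) + 1) / lam) := by
          gcongr with z _ p _
          exact A.length_memory_le_space ω _ (hτ p)
      _ = _ := by
          simp only [Finset.sum_const, Finset.card_univ, Fintype.card_fin, nsmul_eq_mul,
            ← Finset.mul_sum, Finset.sum_add_distrib, ← Finset.sum_div, ← hκ, hS]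
          field_simp
          ring
  have hint := integral_mono (μ := μ)
    (integrable_finsetSum _ fun z _ => integrable_finsetSum _ fun e _ => (houti _).sub (houti _))
    (((integrable_const _).add (hSi.const_mul _)).const_mul _) key
  rw [integral_finsetSum _ fun z _ => integrable_finsetSum _ fun e _ => (houti _).sub (houti _),
    integral_const_mul] at hint
  simp only [Pi.add_apply, Pi.sub_apply] at hint
  rw [integral_add (integrable_const _) (hSi.const_mul _), integral_const,
    integral_const_mul] at hint
  simp only [probReal_univ, one_smul] at hint
  have hgap : ∀ (z : (Fin u → Fin t) × (Fin t → Fin u → Bool)) (e : Fin u), 1 - 2 * δ ≤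
      ∫ ω, (out ω (setColumn e (fun _ => true) (ownedBits z.1 z.2)) -
          out ω (setColumn e (fun _ => false) (ownedBits z.1 z.2))) ∂μ := by
    intro z e
    rw [integral_sub (houti _) (houti _), houtint, houtint]
    have h0 : μ.real (hi (enc (setColumn e (fun _ => false) (ownedBits z.1 z.2)))) ≤ δ :=
      ENNReal.toReal_le_of_le_ofReal hδ0 (hzero z.1 z.2 e)
    have h1 : μ.real (hi (enc (setColumn e (fun _ => true) (ownedBits z.1 z.2))))ᶜ ≤ δ :=
      ENNReal.toReal_le_of_le_ofReal hδ0 (hone z.1 z.2 e)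
    rw [probReal_compl_eq_one_sub (hhim _)] at h1
    linarith
  have hlow := (Finset.sum_le_sum fun z (_ : z ∈ Finset.univ) =>
    Finset.sum_le_sum fun e (_ : e ∈ Finset.univ) => hgap z e)
  simp only [Finset.sum_const, Finset.card_univ, Fintype.card_fin, nsmul_eq_mul, ← hκ] at hlow
  have hfin := hlow.trans (le_trans (le_of_eq (Finset.sum_congr rfl fun z _ =>
    (integral_finsetSum _ fun e _ => (houti _).sub (houti _)).symm)) hint)
  set E := ∫ ω, S ω ∂μ
  have hη : 0 < 1 - 2 * δ := by linarith
  set η := 1 - 2 * δ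
  have hr : 2 * (t : ℝ) * (κ * (t * (lam * u / 2 + 1 / lam)) + t * (2 / lam) * E) =
      κ * (η * u / 2 + 4 * t ^ 4 / η) + 8 * t ^ 4 / η * E := by
    rw [hlam]; field_simp; ring
  rw [hr] at hfin
  have h2 : κ * (η * u / 2 - 4 * t ^ 4 / η) ≤ 8 * t ^ 4 / η * E := by linarith
  have h3 : (κ : ℝ) * (η ^ 2 * u / (16 * t ^ 4) - 1 / 2) =
      (κ * (η * u / 2 - 4 * t ^ 4 / η)) / (8 * t ^ 4 / η) := by
    field_simp; ring
  rw [h3, div_le_iff₀ (by positivity), mul_comm E]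
  exact h2

/-! ### The hard streams -/

/-- The item of the `j`-th block `[j * q, (j + 1) * q)` in the itemset with number `r`: the last
base-`q` digit of `r`, shifted cyclically by the `j`-th digit if `j ≠ 0`. -/
def digitItem (q r j : ℕ) : ℕ := j * q + (r + if j = 0 then 0 else r / q ^ j) % q

lemma digitItem_lt {q r j : ℕ} (hq : 0 < q) : digitItem q r j < (j + 1) * q := by
  have := Nat.mod_lt (r + if j = 0 then 0 else r / q ^ j) hq
  rw [digitItem, add_mul]; omega

lemma digitItem_div {q r j : ℕ} (hq : 0 < q) : digitItem q r j / q = j := by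
  rw [digitItem, add_comm, Nat.add_mul_div_right _ _ hq, Nat.div_eq_of_lt (Nat.mod_lt _ hq),
    zero_add]

/-- A family of `k`-itemsets indexed by `ℕ`, with one item in each of `k` blocks of `q` items. It
is `q ^ k`-periodic without other coincidences, and every `q` consecutive members numbered
`b * q, …, b * q + q - 1` contain each of the `k * q` items exactly once. -/
def digitItemset {n k q : ℕ} (hq : 0 < q) (hn : k * q ≤ n) (r : ℕ) : Transaction n k :=
  ⟨Finset.univ.image fun j : Fin k => (⟨digitItem q r j, (digitItem_lt hq).trans_le
      ((Nat.mul_le_mul_right q j.2).trans hn)⟩ : Fin n), by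
    rw [Finset.card_image_of_injective, Finset.card_univ, Fintype.card_fin]
    intro j j' h
    have := congrArg (fun v : Fin n => (v : ℕ) / q) h
    simp only [digitItem_div hq] at this
    exact Fin.ext this⟩

lemma mem_digitItemset {n k q : ℕ} {hq : 0 < q} {hn : k * q ≤ n} {r : ℕ} {v : Fin n} :
    v ∈ (digitItemset hq hn r).1 ↔ ∃ j < k, digitItem q r j = v := by
  simp only [digitItemset, Finset.mem_image, Finset.mem_univ, true_and, Fin.ext_iff]
  exact ⟨fun ⟨j, h⟩ => ⟨j, j.2, h⟩, fun ⟨j, hj, h⟩ => ⟨⟨j, hj⟩, h⟩⟩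

lemma mod_pow_eq_of_digits_eq {q r r' : ℕ} :
    ∀ k, (∀ j < k, r / q ^ j % q = r' / q ^ j % q) → r % q ^ k = r' % q ^ k
  | 0, _ => by simp [Nat.mod_one]
  | k + 1, h => by
    rw [Nat.mod_pow_succ, Nat.mod_pow_succ,
      mod_pow_eq_of_digits_eq k fun j hj => h j (by omega), h k (by omega)]

lemma mod_eq_of_digitItemset_eq {n k q : ℕ} {hq : 0 < q} {hn : k * q ≤ n} (hk : 0 < k)
    {r r' : ℕ} (h : digitItemset hq hn r = digitItemset hq hn r') : r % q ^ k = r' % q ^ k := by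
  have hitem : ∀ j < k, digitItem q r j = digitItem q r' j := by
    intro j hj
    have hlt := (digitItem_lt (r := r) (j := j) hq).trans_le ((Nat.mul_le_mul_right q hj).trans hn)
    have hmem : (⟨digitItem q r j, hlt⟩ : Fin n) ∈ (digitItemset hq hn r).1 :=
      mem_digitItemset.2 ⟨j, hj, rfl⟩
    rw [h] at hmem
    obtain ⟨j', -, hj'⟩ := mem_digitItemset.1 hmem
    have := congrArg (· / q) hj'
    simp only [digitItem_div hq] at this
    rw [this] at hj'
    exact hj'.symm
  simp only [digitItem, Nat.add_left_cancel_iff] at hitem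
  have h0 : r ≡ r' [MOD q] := by simpa [Nat.ModEq] using hitem 0 hk
  apply mod_pow_eq_of_digits_eq
  intro j hj
  by_cases hj0 : j = 0
  · subst hj0; simpa [Nat.ModEq] using h0
  · have := hitem j hj
    rw [if_neg hj0, if_neg hj0] at this
    exact Nat.ModEq.add_left_cancel h0 this

lemma exists_mem_digitItemset {n k q : ℕ} {hq : 0 < q} {hn : k * q ≤ n} {r₀ : ℕ} {v : Fin n}
    (hv : v ∈ (digitItemset hq hn r₀).1) (b : ℕ) :
    ∃ o < q, v ∈ (digitItemset hq hn (b * q + o)).1 := by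
  obtain ⟨j, hj, hv⟩ := mem_digitItemset.1 hv
  set w := (r₀ + if j = 0 then 0 else r₀ / q ^ j) % q with hw
  have hwq : w < q := Nat.mod_lt _ hq
  -- the shift is the same for all members of the block `b`
  set d := if j = 0 then 0 else b / q ^ (j - 1) with hd
  have hshift : ∀ o < q, (if j = 0 then 0 else (b * q + o) / q ^ j) = d := by
    intro o ho
    rw [hd]
    split_ifs with hj0
    · rfl
    · obtain ⟨i, rfl⟩ := Nat.exists_eq_succ_of_ne_zero hj0
      rw [Nat.succ_eq_add_one, pow_succ', ← Nat.div_div_eq_div_mul, add_comm,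
        Nat.add_mul_div_right _ _ hq, Nat.div_eq_of_lt ho, zero_add, Nat.add_sub_cancel]
  set c := b * q + d with hc
  refine ⟨(w + (q - c % q)) % q, Nat.mod_lt _ hq, mem_digitItemset.2 ⟨j, hj, ?_⟩⟩
  rw [← hv, digitItem, digitItem, ← hw, hshift _ (Nat.mod_lt _ hq), Nat.add_left_cancel_iff,
    show b * q + (w + (q - c % q)) % q + d = (w + (q - c % q)) % q + c by omega, Nat.mod_add_mod]
  have h1 := Nat.div_add_mod c q
  have h2 := Nat.mod_lt c hq
  rw [show w + (q - c % q) + c = w + q * (c / q + 1) by rw [mul_add]; omega,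
    Nat.add_mul_mod_self_left, Nat.mod_eq_of_lt hwq]

/-- Position `i`, in the segment of player `i / (a * u)` and at coordinate `i % u`, carries a `1`. -/
def positionBit {t u : ℕ} (a : ℕ) (β : Fin t → Fin u → Bool) (i : ℕ) : Prop :=
  ∃ (p : Fin t) (e : Fin u), (p : ℕ) = i / (a * u) ∧ (e : ℕ) = i % u ∧ β p e = true

open Classical in
/-- The number of the token at position `i` of a segment: for a `1` at coordinate `e` it is `e`,
common to all players, and for a `0` it is a number used for this coordinate and player only. -/
noncomputable def positionCode {t u : ℕ} (a : ℕ) (β : Fin t → Fin u → Bool) (i : ℕ) : ℕ :=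
  if positionBit a β i then i % u else (i / (a * u) + 1) * u + i % u

/-- The stream of `m` tokens encoding `β`: each of the `t` players in turn lists `a` times the
tokens for the `u` coordinates, and the members of the family `T` follow in their order. -/
noncomputable def disjStream {X : Type} {t u : ℕ} (T : ℕ → X) (a m : ℕ)
    (β : Fin t → Fin u → Bool) : Fin m → X :=
  fun i => if (i : ℕ) < t * (a * u) then T (positionCode a β i) else T (i - t * (a * u))

section Stream

variable {X : Type} {t u a m : ℕ} {T : ℕ → X}

lemma positionCode_congr {β β' : Fin t → Fin u → Bool} {i : ℕ}
    (h : ∀ p : Fin t, (p : ℕ) = i / (a * u) → β p = β' p) :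
    positionCode a β i = positionCode a β' i := by
  have : positionBit a β i ↔ positionBit a β' i := by
    constructor
    · rintro ⟨p, e, hp, he, hb⟩; exact ⟨p, e, hp, he, h p hp ▸ hb⟩
    · rintro ⟨p, e, hp, he, hb⟩; exact ⟨p, e, hp, he, h p hp ▸ hb⟩
  by_cases hb : positionBit a β i
  · rw [positionCode, positionCode, if_pos hb, if_pos (this.1 hb)]
  · rw [positionCode, positionCode, if_neg hb, if_neg (mt this.2 hb)]

lemma disjStream_congr_prefix (p : Fin t) {β β' : Fin t → Fin u → Bool}
    (h : ∀ q ≤ p, β q = β' q) (i : Fin m) (hi : (i : ℕ) < (p + 1) * (a * u)) :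
    disjStream T a m β i = disjStream T a m β' i := by
  unfold disjStream
  rw [positionCode_congr]
  intro q hq
  apply h
  have hau : 0 < a * u := Nat.pos_of_ne_zero fun h0 => by simp [h0] at hi
  rw [Fin.le_def, hq, ← Nat.lt_succ_iff]
  exact (Nat.div_lt_iff_lt_mul hau).2 hi

lemma disjStream_congr_suffix (p : Fin t) {β β' : Fin t → Fin u → Bool}
    (h : ∀ q > p, β q = β' q) (i : Fin m) (hi : (p + 1) * (a * u) ≤ (i : ℕ)) :
    disjStream T a m β i = disjStream T a m β' i := by
  unfold disjStream
  split_ifs with hit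
  · rw [positionCode_congr]
    intro q hq
    apply h
    have hau : 0 < a * u := Nat.pos_of_ne_zero fun h0 => by simp [h0] at hit
    rw [gt_iff_lt, Fin.lt_def, hq]
    exact (Nat.le_div_iff_mul_le hau).2 hi
  · rfl

/-- If no column of `β` has two ones, every token is rare: it occurs at most `a` times in the
segments and at most `5 * a` times after them. -/
lemma card_disjStream_eq_le [DecidableEq X] {Q : ℕ} (hT : ∀ r r', T r = T r' → r % Q = r' % Q)
    (hQ : (t + 1) * u ≤ Q) (hu : 0 < u) (ha : 0 < a) (hm : m < 4 * t * u * a)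
    {β : Fin t → Fin u → Bool} (hβ : ∀ e p p', β p e = true → β p' e = true → p = p') (S : X) :
    (Finset.univ.filter fun i : Fin m => disjStream T a m β i = S).card ≤ 6 * a := by
  classical
  have hQ0 : 0 < Q := lt_of_lt_of_le (by positivity) hQ
  have hau : 0 < a * u := by positivity
  set f1 := Finset.univ.filter fun i : Fin m =>
    (i : ℕ) < t * (a * u) ∧ T (positionCode a β i) = S with hf1
  set f2 := Finset.univ.filter fun i : Fin m =>
    t * (a * u) ≤ (i : ℕ) ∧ T (i - t * (a * u)) = S with hf2
  have hsub : (Finset.univ.filter fun i : Fin m => disjStream T a m β i = S) ⊆ f1 ∪ f2 := by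
    intro i hi
    replace hi := (Finset.mem_filter.1 hi).2
    unfold disjStream at hi
    simp only [hf1, hf2, Finset.mem_union, Finset.mem_filter, Finset.mem_univ, true_and]
    split_ifs at hi with h
    · exact Or.inl ⟨h, hi⟩
    · exact Or.inr ⟨not_lt.1 h, hi⟩
  have h1 : f1.card ≤ a := by
    rcases f1.eq_empty_or_nonempty with h | ⟨i₀, hi₀⟩
    · simp [h]
    have hcode : ∀ i : ℕ, i < t * (a * u) → positionCode a β i < Q := by
      intro i hi
      refine lt_of_lt_of_le ?_ hQ
      have h1 : i / (a * u) < t := (Nat.div_lt_iff_lt_mul hau).2 hi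
      have h2 := Nat.mod_lt i hu
      have h3 : (i / (a * u) + 1) * u ≤ t * u := Nat.mul_le_mul_right u h1
      have h4 : (t + 1) * u = t * u + u := by ring
      unfold positionCode
      split_ifs <;> omega
    have hloc : ∀ i ∈ f1, (i : ℕ) % u = i₀ % u ∧ (i : ℕ) / (a * u) = i₀ / (a * u) := by
      intro i hi
      simp only [hf1, Finset.mem_filter, Finset.mem_univ, true_and] at hi hi₀
      have heq := hT _ _ (hi.2.trans hi₀.2.symm)
      rw [Nat.mod_eq_of_lt (hcode _ hi.1), Nat.mod_eq_of_lt (hcode _ hi₀.1)] at heq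
      have hmi := Nat.mod_lt (i : ℕ) hu
      have hmi₀ := Nat.mod_lt (i₀ : ℕ) hu
      unfold positionCode at heq
      split_ifs at heq with hb hb₀ hb₀
      · obtain ⟨p, e, hp, he, hpe⟩ := hb
        obtain ⟨p', e', hp', he', hpe'⟩ := hb₀
        obtain rfl : e = e' := Fin.ext (by omega)
        obtain rfl := hβ e p p' hpe hpe'
        exact ⟨heq, hp.symm.trans hp'⟩
      · rw [add_mul] at heq; omega
      · rw [add_mul] at heq; omega
      · have hmod := congrArg (· % u) heq
        have hdiv := congrArg (· / u) heq
        simp only [Nat.mul_add_mod', Nat.mod_mod] at hmod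
        simp only [add_comm _ ((_ : ℕ) % u), Nat.add_mul_div_right _ _ hu, Nat.div_eq_of_lt hmi,
          Nat.div_eq_of_lt hmi₀] at hdiv
        exact ⟨hmod, by omega⟩
    calc f1.card ≤ (Finset.Ico (i₀ / (a * u) * a) (i₀ / (a * u) * a + a)).card := by
          apply Finset.card_le_card_of_injOn (fun i : Fin m => (i : ℕ) / u)
          · intro i hi
            have h := (hloc i hi).2
            rw [mul_comm a u, ← Nat.div_div_eq_div_mul] at h
            have h2 := Nat.div_add_mod ((i : ℕ) / u) a
            have h3 := Nat.mod_lt ((i : ℕ) / u) ha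
            rw [h, mul_comm a, mul_comm u a] at h2
            rw [Finset.mem_coe, Finset.mem_Ico]
            dsimp only
            omega
          · intro i hi i' hi' h
            have h1 := Nat.div_add_mod (i : ℕ) u
            have h2 := Nat.div_add_mod (i' : ℕ) u
            dsimp only at h
            rw [(hloc i hi).1, h] at h1
            rw [(hloc i' hi').1] at h2
            exact Fin.ext (h1.symm.trans h2)
      _ = a := by simp
  have h2 : f2.card ≤ m / Q + 1 := by
    calc f2.card ≤ (Finset.range (m / Q + 1)).card := by
          apply Finset.card_le_card_of_injOn (fun i : Fin m => ((i : ℕ) - t * (a * u)) / Q)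
          · intro i _
            rw [Finset.mem_coe, Finset.mem_range, Nat.lt_succ_iff]
            exact Nat.div_le_div_right (by omega)
          · intro i hi i' hi' h
            simp only [hf2, Finset.coe_filter, Finset.mem_univ, true_and, Set.mem_ofPred_eq]
              at hi hi'
            have hmod := hT _ _ (hi.2.trans hi'.2.symm)
            have h1 := Nat.div_add_mod ((i : ℕ) - t * (a * u)) Q
            have h2 := Nat.div_add_mod ((i' : ℕ) - t * (a * u)) Q
            dsimp only at h
            rw [h, hmod] at h1
            exact Fin.ext (by omega)
      _ = _ := by simp
  have h3 : m / Q ≤ 4 * a := by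
    rw [← Nat.lt_succ_iff, Nat.div_lt_iff_lt_mul hQ0]
    nlinarith [Nat.mul_le_mul_left (4 * a) hQ]
  calc _ ≤ (f1 ∪ f2).card := Finset.card_le_card hsub
    _ ≤ f1.card + f2.card := Finset.card_union_le _ _
    _ ≤ _ := by omega

/-- The token shared by a column of ones occurs `a` times in each segment. -/
lemma mul_le_card_disjStream_eq [DecidableEq X] (hm : t * (a * u) ≤ m)
    {β : Fin t → Fin u → Bool} {e : Fin u} (hβ : ∀ p, β p e = true) :
    t * a ≤ (Finset.univ.filter fun i : Fin m => disjStream T a m β i = T e).card := by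
  have hlt : ∀ w : Fin (t * a), (w : ℕ) * u + e < t * (a * u) := by
    intro w
    have h1 : ((w : ℕ) + 1) * u ≤ t * a * u := Nat.mul_le_mul_right u w.2
    have h2 := e.2
    rw [add_mul] at h1
    rw [← mul_assoc]; omega
  have hu : 0 < u := e.pos
  calc t * a = (Finset.univ : Finset (Fin (t * a))).card := by simp
    _ ≤ _ := by
      apply Finset.card_le_card_of_injOn
        (fun w : Fin (t * a) => (⟨(w : ℕ) * u + e, (hlt w).trans_le hm⟩ : Fin m))
      · intro w _
        rw [Finset.mem_coe, Finset.mem_filter]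
        refine ⟨Finset.mem_univ _, ?_⟩
        rw [disjStream, if_pos (hlt w)]
        have hmod : ((w : ℕ) * u + e) % u = e := by
          rw [Nat.mul_add_mod', Nat.mod_eq_of_lt e.2]
        have hau : 0 < a * u := Nat.pos_of_ne_zero fun h0 => by
          have := hlt w; simp [h0] at this
        have hbit : positionBit a β ((w : ℕ) * u + e) :=
          ⟨⟨((w : ℕ) * u + e) / (a * u), (Nat.div_lt_iff_lt_mul hau).2 (hlt w)⟩, e, rfl,
            hmod.symm, hβ _⟩
        rw [positionCode, if_pos hbit]
        exact congrArg T hmod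
      · intro w _ w' _ h
        have := congrArg Fin.val h
        simp only [Nat.add_right_cancel_iff] at this
        exact Fin.ext (Nat.eq_of_mul_eq_mul_right hu this)

end Stream

section MaxSupport

variable {n k q t u a m φ : ℕ} {hq : 0 < q} {hn : k * q ≤ n}

lemma itemsetSupport_eq_card (x : Fin m → Transaction n k) (S : Transaction n k) :
    itemsetSupport x S.1 = (Finset.univ.filter fun i => x i = S).card := by
  unfold itemsetSupport
  congr 1
  ext i
  simp only [Finset.mem_filter, Finset.mem_univ, true_and]
  constructor
  · intro h
    exact Subtype.ext (Finset.eq_of_subset_of_card_le h (by rw [(x i).2, S.2])).symm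
  · rintro h; rw [h]

/-- The tail of the stream alone makes all items of the family frequent. -/
lemma le_itemsetSupport_singleton (hφ : t * (a * u) + φ * q ≤ m) (β : Fin t → Fin u → Bool)
    {r : ℕ} {v : Fin n} (hv : v ∈ (digitItemset hq hn r).1) :
    φ ≤ itemsetSupport (disjStream (digitItemset hq hn) a m β) {v} := by
  choose o ho hmem using fun b : ℕ => exists_mem_digitItemset hv b
  have hlt : ∀ b : Fin φ, t * (a * u) + (b * q + o b) < m := by
    intro b
    have h1 : ((b : ℕ) + 1) * q ≤ φ * q := Nat.mul_le_mul_right q b.2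
    have := ho b
    rw [add_mul] at h1
    omega
  calc φ = (Finset.univ : Finset (Fin φ)).card := by simp
    _ ≤ _ := by
      apply Finset.card_le_card_of_injOn
        (fun b : Fin φ => (⟨t * (a * u) + (b * q + o b), hlt b⟩ : Fin m))
      · intro b _
        simp only [Finset.coe_filter, Finset.mem_univ, true_and, Set.mem_ofPred_eq, disjStream,
          Finset.singleton_subset_iff]
        rw [if_neg (by omega), Nat.add_sub_cancel_left]
        exact hmem b
      · intro b _ b' _ h
        have h1 := congrArg (fun i : Fin m => ((i : ℕ) - t * (a * u)) / q) h
        simp only [Nat.add_sub_cancel_left, add_comm _ (o _), Nat.add_mul_div_right _ _ hq,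
          Nat.div_eq_of_lt (ho _), zero_add] at h1
        exact Fin.ext h1

lemma itemsetSupport_le_maxSupport (hφ : t * (a * u) + φ * q ≤ m) (β : Fin t → Fin u → Bool)
    (r : ℕ) :
    itemsetSupport (disjStream (digitItemset hq hn) a m β) (digitItemset hq hn r).1 ≤
      maxSupport φ (disjStream (digitItemset hq hn) a m β) := by
  unfold maxSupport
  apply Finset.le_sup (f := itemsetSupport (disjStream (digitItemset hq hn) a m β))
  simp only [Finset.mem_filter, Finset.mem_powersetCard, Finset.subset_univ, true_and]
  exact ⟨(digitItemset hq hn r).2, fun i hi => le_itemsetSupport_singleton hφ β hi⟩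

lemma maxSupport_disjStream_pos (hφ0 : 0 < φ) (hφ : t * (a * u) + φ * q ≤ m)
    (β : Fin t → Fin u → Bool) : 0 < maxSupport φ (disjStream (digitItemset hq hn) a m β) := by
  refine lt_of_lt_of_le ?_ (itemsetSupport_le_maxSupport hφ β 0)
  have hφq : 0 < φ * q := by positivity
  rw [itemsetSupport_eq_card, Finset.card_pos]
  refine ⟨⟨t * (a * u), by omega⟩, ?_⟩
  rw [Finset.mem_filter]
  exact ⟨Finset.mem_univ _, by simp [disjStream]⟩

lemma mul_le_maxSupport_disjStream (hφ : t * (a * u) + φ * q ≤ m)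
    {β : Fin t → Fin u → Bool} {e : Fin u} (hβ : ∀ p, β p e = true) :
    t * a ≤ maxSupport φ (disjStream (digitItemset hq hn) a m β) := by
  refine le_trans ?_ (itemsetSupport_le_maxSupport hφ β e)
  rw [itemsetSupport_eq_card]
  exact mul_le_card_disjStream_eq (by omega) hβ

lemma maxSupport_disjStream_le (hk : 0 < k) (hQ : (t + 1) * u ≤ q ^ k) (hu : 0 < u) (ha : 0 < a)
    (hm : m < 4 * t * u * a) {β : Fin t → Fin u → Bool}
    (hβ : ∀ e p p', β p e = true → β p' e = true → p = p') :
    maxSupport φ (disjStream (digitItemset hq hn) a m β) ≤ 6 * a := by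
  unfold maxSupport
  refine Finset.sup_le fun S hS => ?_
  have hcard := (Finset.mem_powersetCard.1 (Finset.mem_filter.1 hS).1).2
  rw [show S = (⟨S, hcard⟩ : Transaction n k).1 from rfl, itemsetSupport_eq_card]
  exact card_disjStream_eq_le (fun r r' => mod_eq_of_digitItemset_eq hk) hQ hu ha hm hβ _

end MaxSupport

/-! ### Parameters and the lower bound -/

lemma div_sub_one_lt_natCast_div (x : ℕ) {y : ℕ} (hy : 0 < y) :
    (x : ℝ) / y - 1 < ((x / y : ℕ) : ℝ) := by
  rw [sub_lt_iff_lt_add, div_lt_iff₀ (by exact_mod_cast hy), mul_comm]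
  exact_mod_cast Nat.lt_mul_div_succ x hy

/-- Choice of the block length `q`, the number `u` of coordinates and the multiplicity `a` for
`24` players. -/
lemma exists_disjStream_parameters {k m n φ : ℕ} (hk : 0 < k) (hφ : 0 < φ)
    (hB : 96 * (4 * k : ℝ) ^ k ≤ spaceBound k m n φ) :
    ∃ q u a : ℕ, 0 < q ∧ k * q ≤ n ∧ 0 < u ∧ 0 < a ∧ (24 + 1) * u ≤ q ^ k ∧
      m < 4 * 24 * u * a ∧ 24 * (a * u) + φ * q ≤ m ∧
      spaceBound k m n φ / (96 * (4 * k : ℝ) ^ k) ≤ u := by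
  have hk1 : (1 : ℝ) ≤ k := by exact_mod_cast hk
  have hφ1 : (1 : ℝ) ≤ φ := by exact_mod_cast hφ
  set K : ℝ := (4 * k : ℝ) ^ k with hK
  have hK1 : 1 ≤ K := one_le_pow₀ (by linarith)
  set B := spaceBound k m n φ with hBdef
  have hBm : B ≤ m := min_le_left _ _
  have hBn : B ≤ (n : ℝ) ^ k := (min_le_right _ _).trans (min_le_left _ _)
  have hBφ : B ≤ ((m : ℝ) / φ) ^ k := (min_le_right _ _).trans (min_le_right _ _)
  have hKB : K ≤ B := by linarith
  have hn4 : 4 * (k : ℝ) ≤ n :=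
    le_of_pow_le_pow_left₀ hk.ne' (by positivity) (hKB.trans hBn)
  have hm4 : 4 * (k : ℝ) ≤ (m : ℝ) / φ :=
    le_of_pow_le_pow_left₀ hk.ne' (by positivity) (hKB.trans hBφ)
  set q := min (n / k) (m / (2 * φ)) with hq
  have hq1 : (n : ℝ) / (4 * k) ≤ ((n / k : ℕ) : ℝ) := by
    have h1 := div_sub_one_lt_natCast_div n hk
    have h2 : 4 ≤ (n : ℝ) / k := by rw [le_div_iff₀ (by linarith)]; exact hn4
    have h3 : (n : ℝ) / (4 * k) = (n : ℝ) / k / 4 := by rw [div_div, mul_comm]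
    linarith
  have hq2 : (m : ℝ) / φ / (4 * k) ≤ ((m / (2 * φ) : ℕ) : ℝ) := by
    have h1 := div_sub_one_lt_natCast_div m (y := 2 * φ) (by omega)
    have h2 : (m : ℝ) / ((2 * φ : ℕ) : ℝ) = (m : ℝ) / φ / 2 := by
      push_cast; rw [div_div, mul_comm]
    have h3 : (m : ℝ) / φ / (4 * k) ≤ (m : ℝ) / φ / 4 :=
      div_le_div_of_nonneg_left (by positivity) (by norm_num) (by linarith)
    rw [h2] at h1
    linarith
  have hqK : B / K ≤ (q : ℝ) ^ k := by
    rw [hK, hq, Nat.cast_min]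
    rcases le_total ((n / k : ℕ) : ℝ) ((m / (2 * φ) : ℕ) : ℝ) with h | h
    · rw [min_eq_left h]
      calc B / (4 * k : ℝ) ^ k ≤ (n : ℝ) ^ k / (4 * k : ℝ) ^ k := by gcongr
        _ = ((n : ℝ) / (4 * k)) ^ k := (div_pow _ _ _).symm
        _ ≤ _ := by gcongr
    · rw [min_eq_right h]
      calc B / (4 * k : ℝ) ^ k ≤ ((m : ℝ) / φ) ^ k / (4 * k : ℝ) ^ k := by gcongr
        _ = ((m : ℝ) / φ / (4 * k)) ^ k := (div_pow _ _ _).symm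
        _ ≤ _ := by gcongr
  have hx : 96 ≤ B / K := by rw [le_div_iff₀ (by linarith)]; exact hB
  have hxB : B / K ≤ B := div_le_self (by linarith) hK1
  have hq0 : 0 < q := by
    apply Nat.pos_of_ne_zero
    intro h0
    rw [h0, Nat.cast_zero, zero_pow hk.ne'] at hqK
    linarith
  set u := min (q ^ k / 25) (m / 48) with hu
  have hux : B / K / 96 ≤ u := by
    rw [hu, Nat.cast_min, le_min_iff]
    have h1 := div_sub_one_lt_natCast_div (q ^ k) (y := 25) (by norm_num)
    have h2 := div_sub_one_lt_natCast_div m (y := 48) (by norm_num)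
    push_cast at h1 h2
    constructor <;> linarith
  have hu0 : 0 < u := by
    have : (0 : ℝ) < u := by linarith
    exact_mod_cast this
  have hu1 : u * 25 ≤ q ^ k := (Nat.le_div_iff_mul_le (by norm_num)).1 (min_le_left _ _)
  have hu2 : u * 48 ≤ m := (Nat.le_div_iff_mul_le (by norm_num)).1 (min_le_right _ _)
  have ha0 : 0 < m / (48 * u) := Nat.div_pos (by omega) (by omega)
  have hqn : q * k ≤ n := (Nat.le_div_iff_mul_le hk).1 (min_le_left _ _)
  have hqφ : q * (2 * φ) ≤ m := (Nat.le_div_iff_mul_le (by omega)).1 (min_le_right _ _)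
  have ha1 : 48 * u * (m / (48 * u)) ≤ m := Nat.mul_div_le _ _
  have ha2 : m < 48 * u * (m / (48 * u) + 1) := Nat.lt_mul_div_succ m (by omega)
  refine ⟨q, u, m / (48 * u), hq0, by rwa [mul_comm], hu0, ha0, by omega, ?_, ?_, ?_⟩
  · generalize m / (48 * u) = a at *
    nlinarith
  · generalize m / (48 * u) = a at *
    nlinarith
  · rwa [mul_comm, ← div_div]

lemma expectedSpace_map_uniformOfFintype {Ω : Type*} [MeasurableSpace Ω] {n k m : ℕ}
    (A : StreamingAlgorithm Ω (Transaction n k)) (μ : Measure Ω) {Z : Type} [Fintype Z]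
    [Nonempty Z] (f : Z → Fin m → Transaction n k) :
    A.expectedSpace μ ((PMF.uniformOfFintype Z).map f) =
      (Fintype.card Z : ℝ≥0∞)⁻¹ * ∑ z, ∫⁻ ω, (A.space ω (f z) : ℝ≥0∞) ∂μ := by
  classical
  simp only [StreamingAlgorithm.expectedSpace, PMF.map_apply, tsum_fintype,
    PMF.uniformOfFintype_apply, Finset.sum_mul, ite_mul, zero_mul]
  rw [Finset.sum_comm, Finset.mul_sum]
  refine Finset.sum_congr rfl fun z _ => ?_
  simp

theorem theorem1 (k : ℕ) (hk : 0 < k) (δ : ℝ) (hδ0 : 0 ≤ δ) (hδ : δ < 1 / 2) :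
    ∃ c : ℝ, 0 < c ∧ ∃ N : ℝ, ∀ α : ℝ, 1 ≤ α → α < 2 → ∀ m n φ : ℕ, 0 < φ →
      N ≤ spaceBound k m n φ →
      ∃ D : PMF (Fin m → Transaction n k), (∀ x ∈ D.support, 0 < maxSupport φ x) ∧
        ∀ (Ω : Type*) [MeasurableSpace Ω] (P : Measure Ω) [IsProbabilityMeasure P]
          (A : StreamingAlgorithm Ω (Transaction n k)),
          A.EstimatesMaxSupport P m φ α δ →
            ENNReal.ofReal (c * spaceBound k m n φ) ≤ A.expectedSpace P D := by
  set L : ℝ := 96 * (4 * k : ℝ) ^ k with hL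
  have hk0 : (0 : ℝ) < k := by exact_mod_cast hk
  have hL0 : 0 < L := by positivity
  have hη : 0 < 1 - 2 * δ := by linarith
  set γ : ℝ := (1 - 2 * δ) ^ 2 / (16 * 24 ^ 4) with hγ
  have hγ0 : 0 < γ := by positivity
  refine ⟨γ / (2 * L), by positivity, max L (L / γ), ?_⟩
  intro α hα1 hα2 m n φ hφ hN
  -- With `24` players the supports to tell apart are at most `6 * a` and at least `24 * a`: as
  -- `α < 2`, their `α`-approximations lie on different sides of `12 * a`.
  obtain ⟨q, u, a, hq, hn, hu, ha, hQ, hm, hφm, hBu⟩ :=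
    exists_disjStream_parameters (n := n) hk hφ ((le_max_left _ _).trans hN)
  set enc : (Fin 24 → Fin u → Bool) → Fin m → Transaction n k :=
    disjStream (digitItemset hq hn) a m with henc
  refine ⟨(PMF.uniformOfFintype ((Fin u → Fin 24) × (Fin 24 → Fin u → Bool))).map
    fun z => enc (ownedBits z.1 z.2), ?_, ?_⟩
  · intro x hx
    obtain ⟨z, -, rfl⟩ := (PMF.mem_support_map_iff _ _ _).1 hx
    exact maxSupport_disjStream_pos hφ hφm _
  intro Ω _ μ _ A hA
  have ha' : (0 : ℝ) < a := by exact_mod_cast ha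
  have key := le_sum_lintegral_space μ A (t := 24) (u := u) (by norm_num) enc
    (fun p => (p + 1) * (a * u))
    (fun p => le_trans (Nat.mul_le_mul_right _ p.2) (by omega : 24 * (a * u) ≤ m))
    (fun p β β' h i hi => disjStream_congr_prefix p h i hi)
    (fun p β β' h i hi => disjStream_congr_suffix p h i hi)
    (θ := 12 * a) hδ0 hδ ?_ ?_
  · rw [expectedSpace_map_uniformOfFintype]
    set κ := Fintype.card ((Fin u → Fin 24) × (Fin 24 → Fin u → Bool)) with hκ
    have hκ0 : 0 < κ := Fintype.card_pos
    rw [ENNReal.ofReal_mul (by positivity), ENNReal.ofReal_natCast] at key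
    refine le_trans ?_ (mul_le_mul_right key _)
    rw [← mul_assoc (κ : ℝ≥0∞)⁻¹, ENNReal.inv_mul_cancel (by exact_mod_cast hκ0.ne')
      (ENNReal.natCast_ne_top _), one_mul]
    apply ENNReal.ofReal_le_ofReal
    rw [← hL] at hBu
    have h1 : 1 / γ ≤ spaceBound k m n φ / L := by
      rw [le_div_iff₀ hL0, div_mul_eq_mul_div, one_mul]
      exact (le_max_right _ _).trans hN
    have h2 : 1 ≤ γ * (spaceBound k m n φ / L) := by
      rw [div_le_iff₀ hγ0] at h1; linarith
    have h3 : γ * (spaceBound k m n φ / L) ≤ γ * u := by gcongr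
    have h4 : γ / (2 * L) * spaceBound k m n φ = γ * (spaceBound k m n φ / L) / 2 := by
      field_simp
    have h5 : (1 - 2 * δ) ^ 2 * (u : ℝ) / (16 * ((24 : ℕ) : ℝ) ^ 4) = γ * u := by
      rw [hγ]; push_cast; ring
    rw [h4, h5]
    linarith
  · intro P Y e
    set β := setColumn e (fun _ => true) (ownedBits P Y)
    refine le_trans (measure_mono ?_) (hA (enc β) (maxSupport_disjStream_pos hφ hφm _))
    intro ω hω hgood
    apply hω
    have hs : (24 * a : ℝ) ≤ maxSupport φ (enc β) := by
      have := mul_le_maxSupport_disjStream (hq := hq) (hn := hn) hφm (β := β) (e := e)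
        fun p => by simp [β, setColumn]
      exact_mod_cast this
    refine le_trans ?_ hgood.1
    rw [le_div_iff₀ (by linarith)]
    nlinarith
  · intro P Y e
    set β := setColumn e (fun _ => false) (ownedBits P Y) with hβ
    have hpos : 0 < maxSupport φ (enc β) := maxSupport_disjStream_pos hφ hφm _
    refine le_trans (measure_mono ?_) (hA (enc β) hpos)
    intro ω hω hgood
    have hs : (maxSupport φ (enc β) : ℝ) ≤ 6 * a := by
      have := maxSupport_disjStream_le (hq := hq) (hn := hn) (φ := φ) hk hQ hu ha hm (β := β) ?_
      · exact_mod_cast this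
      · intro e' p p' hp hp'
        by_cases he : e' = e
        · subst he; simp [β, setColumn] at hp
        · simp only [hβ, setColumn, Function.update_of_ne he, ownedBits, Bool.and_eq_true,
            decide_eq_true_eq] at hp hp'
          exact hp.1.symm.trans hp'.1
    have hpos' : (0 : ℝ) < maxSupport φ (enc β) := by exact_mod_cast hpos
    have h1 : 12 * (a : ℝ) ≤ A.result ω (enc β) := hω
    have h2 := hgood.2
    nlinarith
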